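/- Let $R$ be an arbitrary associative ring with $1$; modules are unitary left $R$-modules. A unary pp formula is a formula $\varphi(x)$ of the form $\exists y_1\dots\exists y_k\,(A\bar y = \bar b\,x)$, where $A$ is an $m\times k$ matrix and $\bar b$ a column of length $m$ over $R$; it defines in each module $M$ the pp subgroup $\varphi(M)\subseteq M$ of all elements satisfying it. A submodule $M$ of $L$ is pure in $L$ if $M\cap\varphi(L)=\varphi(M)$ for all unary pp formulas $\varphi$. A module is absolutely pure if it is pure in every module containing it, and pure-injective if it is injective with respect to pure embeddings. A unary pp formula $\varphi$ is high if $\varphi(M)=M$ for every absolutely pure module $M$. The first Ulm submodule of a module $M$ is $$u(M)=\bigcap_{\varphi\ \text{high}}\varphi(M).$$ Put $u^0(M)=M$, $u^{\alpha+1}(M)=u(u^\alpha(M))$ for every ordinal $\alpha$, and $u^\delta(M)=\bigcap_{\alpha<\delta}u^\alpha(M)$ for every limit ordinal $\delta$. The Ulm length of $M$ is the smallest ordinal $\tau$ such that $u^{\tau+1}(M)=u^\tau(M)$. Theorem. Let $N$ be a pure-injective left $R$-module. Then $u(N)$ is pure-injective and has Ulm length $0$, i.e. $u(u(N))=u(N)$.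 Consequently, $N$ has Ulm length at most $1$. -/

import Mathlib

universe u v w

/-- A unary positive primitive formula for left `R`-modules:
`∃ y₁ … y_k, A y = b x`, with `A` an `m × k` matrix and `b` a column of length `m` over `R`. -/
structure PPFormula (R : Type u) where
  numEqs : ℕ
  numVars : ℕ
  A : Matrix (Fin numEqs) (Fin numVars) R
  b : Fin numEqs → R

namespace PPFormula

variable {R : Type u} [Ring R]

/-- `φ.Holds x`: the element `x` of the module `M` satisfies `φ` in `M`. -/
def Holds (φ : PPFormula R) {M : Type v} [AddCommGroup M] [Module R M] (x : M) : Prop :=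
  ∃ y : Fin φ.numVars → M, ∀ i, ∑ j, φ.A i j • y j = φ.b i • x

/-- The pp subgroup `φ(M)` defined by `φ` in the module `M`. -/
def subgroup (φ : PPFormula R) (M : Type v) [AddCommGroup M] [Module R M] : AddSubgroup M where
  carrier := {x | φ.Holds x}
  zero_mem' := ⟨0, fun i => by simp⟩
  add_mem' := by
    rintro a c ⟨y, hy⟩ ⟨z, hz⟩
    exact ⟨y + z, fun i => by simp [Finset.sum_add_distrib, hy i, hz i]⟩
  neg_mem' := by
    rintro a ⟨y, hy⟩
    exact ⟨-y, fun i => by simp [hy i]⟩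

/-- The formula `φ(r x)`. -/
def substSMul (φ : PPFormula R) (r : R) : PPFormula R where
  numEqs := φ.numEqs
  numVars := φ.numVars
  A := φ.A
  b := fun i => φ.b i * r

theorem mem_subgroup_substSMul (φ : PPFormula R) (r : R) {M : Type v} [AddCommGroup M]
    [Module R M] (x : M) : x ∈ (φ.substSMul r).subgroup M ↔ r • x ∈ φ.subgroup M := by
  change (∃ y : Fin φ.numVars → M, ∀ i, ∑ j, φ.A i j • y j = (φ.b i * r) • x) ↔
    ∃ y : Fin φ.numVars → M, ∀ i, ∑ j, φ.A i j • y j = φ.b i • r • x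
  simp only [mul_smul]

end PPFormula

/-- An injective linear map `f : M → N` is a pure embedding if its image is a pure submodule:
an element of `M` whose image lies in `φ(N)` lies in `φ(M)`, for every unary pp formula `φ`. -/
def IsPureEmbedding {R : Type u} [Ring R] {M : Type v} {N : Type w} [AddCommGroup M] [Module R M]
    [AddCommGroup N] [Module R N] (f : M →ₗ[R] N) : Prop :=
  Function.Injective f ∧
    ∀ (φ : PPFormula R) (x : M), f x ∈ φ.subgroup N → x ∈ φ.subgroup M

/-- A module is absolutely pure if it is pure in every module containing it. The containing
modules range over a universe large enough for the injective envelope of `M`. -/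
def IsAbsolutelyPure (R : Type u) [Ring R] (M : Type v) [AddCommGroup M] [Module R M] : Prop :=
  ∀ (L : Type (max u v)) [AddCommGroup L] [Module R L] (f : M →ₗ[R] L),
    Function.Injective f → IsPureEmbedding f

/-- A module is pure-injective if it is injective over pure embeddings. The test modules range
over a universe large enough for the pure-injective envelope of `N`. -/
def IsPureInjective (R : Type u) [Ring R] (N : Type v) [AddCommGroup N] [Module R N] : Prop :=
  ∀ (A B : Type (max u v)) [AddCommGroup A] [Module R A] [AddCommGroup B] [Module R B]
    (f : A →ₗ[R] B), IsPureEmbedding f → ∀ g : A →ₗ[R] N, ∃ h : B →ₗ[R] N, h ∘ₗ f = g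

/-- A unary pp formula is high if `φ(M) = M` for every absolutely pure left `R`-module `M`. The
modules `M` range over `Type (max u v)`. Whatever `v` is, this universe contains the injective
envelope of `R`, so the notion does not depend on `v`. -/
def PPFormula.IsHigh {R : Type u} [Ring R] (φ : PPFormula R) : Prop :=
  ∀ (M : Type (max u v)) [AddCommGroup M] [Module R M],
    IsAbsolutelyPure R M → φ.subgroup M = ⊤

/-- The first Ulm submodule `u(M)`: the intersection of all high pp subgroups `φ(M)`. -/
def ulm (R : Type u) [Ring R] (M : Type v) [AddCommGroup M] [Module R M] : Submodule R M where
  carrier := {x | ∀ φ : PPFormula R, PPFormula.IsHigh.{u, v} φ → x ∈ φ.subgroup M}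
  zero_mem' := fun φ _ => (φ.subgroup M).zero_mem
  add_mem' := fun ha hc φ hφ => (φ.subgroup M).add_mem (ha φ hφ) (hc φ hφ)
  smul_mem' := fun r x hx φ hφ =>
    (φ.mem_subgroup_substSMul r x).1 <| hx (φ.substSMul r) fun L _ _ hL => by
      ext z
      rw [φ.mem_subgroup_substSMul r z, hφ L hL]
      simp

/-- The first Ulm submodule `u(P)` of a submodule `P` of `M`, as a submodule of `M`. -/
def ulmOf {R : Type u} [Ring R] {M : Type v} [AddCommGroup M] [Module R M]
    (P : Submodule R M) : Submodule R M :=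
  (ulm R P).map P.subtype

/-- The Ulm sequence of `M`: `u⁰(M) = M`, `u^(α+1)(M) = u(u^α(M))`, and
`u^δ(M) = ⋂_{α < δ} u^α(M)` for limit ordinals `δ`. -/
noncomputable def ulmSeq (R : Type u) [Ring R] (M : Type v) [AddCommGroup M] [Module R M]
    (α : Ordinal.{v}) : Submodule R M :=
  Ordinal.limitRecOn (motive := fun _ => Submodule R M) α ⊤ (fun _ P => ulmOf P)
    (fun δ _ P => ⨅ β : Set.Iio δ, P β.1 β.2)

/-- `τ` is the Ulm length of `M`: the smallest ordinal with `u^(τ+1)(M) = u^τ(M)`. -/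
def HasUlmLength (R : Type u) [Ring R] (M : Type v) [AddCommGroup M] [Module R M]
    (τ : Ordinal.{v}) : Prop :=
  IsLeast {α : Ordinal.{v} | ulmSeq R M (α + 1) = ulmSeq R M α} τ

/-! Embed `R` in an injective module `E` by `e`. Every map `E → N` has its image in u(N), because
`E` is absolutely pure. Given a pure embedding `f : A → B` and `g : A → N` with values in u(N), form
the pushout of `N` and `B` over `A`, and for each `b` in `B` attach a copy of `E` in which `e 1` is
identified with `b`. The crux is `isPureEmbedding_gluing`: `N` is pure in the result. Each attached
copy imposes only conditions satisfied by `e 1`; these are high formulas, so the values of `g`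
already satisfy them in `N`. As `N` is pure-injective, the glued module retracts onto `N`. On `B`
the retraction extends `g`, and each of its values is the image of `e 1` under a map `E → N`, hence
lies in u(N). This gives pure-injectivity of u(N); taking `f` to be the identity of u(N) gives
u(u(N)) = u(N). -/

/-! ### Purity and finite linear systems -/

section Holds

variable {R : Type u} [Ring R] {M : Type v} {N : Type w} [AddCommGroup M] [Module R M]
  [AddCommGroup N] [Module R N]

/-- Linear maps preserve pp formulas. -/
theorem PPFormula.map_mem_subgroup (φ : PPFormula R) (f : M →ₗ[R] N) {x : M}
    (hx : x ∈ φ.subgroup M) : f x ∈ φ.subgroup N := by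
  obtain ⟨y, hy⟩ := hx
  exact ⟨f ∘ y, fun i => by simpa using congrArg f (hy i)⟩

/-- A linear map with a linear retraction is a pure embedding. -/
theorem IsPureEmbedding.of_leftInverse (f : M →ₗ[R] N) (g : N →ₗ[R] M)
    (h : Function.LeftInverse g f) : IsPureEmbedding f :=
  ⟨h.injective, fun φ x hx => by simpa [h x] using φ.map_mem_subgroup g hx⟩

/-- Purity for finite systems of linear equations with several parameters follows from purity for
unary pp formulas. -/
theorem IsPureEmbedding.exists_solution_params {f : M →ₗ[R] N} (hf : IsPureEmbedding f) {m : ℕ}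
    (n : ℕ) : ∀ (k : ℕ) (A : Fin m → Fin k → R) (D : Fin m → Fin n → R) (c : Fin n → M)
    (y : Fin k → N), (∀ i, ∑ j, A i j • y j = ∑ l, D i l • f (c l)) →
    ∃ z : Fin k → M, ∀ i, ∑ j, A i j • z j = ∑ l, D i l • c l := by
  induction n with
  | zero => exact fun k A D c y _ => ⟨0, fun i => by simp⟩
  | succ n ih =>
    intro k A D c y hy
    -- The parameter `c 0` becomes an extra unknown; `z 0` is the value found for it in `M`.
    obtain ⟨z, hz⟩ := ih (k + 1) (fun i => Fin.cons (-D i 0) (A i)) (fun i l => D i l.succ)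
      (fun l => c l.succ) (Fin.cons (f (c 0)) y) fun i => by
        simp [Fin.sum_univ_succ, hy i]
    -- Subtracting the two solutions leaves a system whose only parameter is `c 0 - z 0`, so unary
    -- purity applies.
    obtain ⟨z', hz'⟩ := hf.2 ⟨m, k, A, fun i => D i 0⟩ (c 0 - z 0)
      ⟨fun j => y j - f (z j.succ), fun i => by
        have h := congrArg f (hz i)
        simp only [Fin.sum_univ_succ, Fin.cons_zero, Fin.cons_succ, map_add, map_smul, map_sum,
          map_neg, neg_smul] at h
        have h' := hy i
        rw [Fin.sum_univ_succ, ← h] at h'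
        simp only [smul_sub, Finset.sum_sub_distrib, h', map_sub]
        abel⟩
    refine ⟨fun j => z' j + z j.succ, fun i => ?_⟩
    have h := hz i
    have h' := hz' i
    simp only [Fin.sum_univ_succ, Fin.cons_zero, Fin.cons_succ, neg_smul] at h
    simp only [smul_add, Finset.sum_add_distrib] at h' ⊢
    rw [h', Fin.sum_univ_succ, ← h, smul_sub]
    abel

/-- A finite system of linear equations over `M` that is solvable in a pure extension is solvable
in `M`. -/
theorem IsPureEmbedding.exists_solution {f : M →ₗ[R] N} (hf : IsPureEmbedding f) {m : ℕ}
    {ι : Type*} [Fintype ι] (A : Fin m → ι → R) (c : Fin m → M) (y : ι → N)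
    (hy : ∀ i, ∑ j, A i j • y j = f (c i)) : ∃ z : ι → M, ∀ i, ∑ j, A i j • z j = c i := by
  let e := Fintype.equivFin ι
  obtain ⟨z, hz⟩ := hf.exists_solution_params m _ (fun i j => A i (e.symm j))
    (fun i l => if i = l then 1 else 0) c (y ∘ e.symm) fun i => by
      simpa [ite_smul] using (e.symm.sum_comp fun j => A i j • y j).trans (hy i)
  refine ⟨z ∘ e, fun i => ?_⟩
  rw [← e.symm.sum_comp]
  simpa [ite_smul] using hz i

end Holds

/-! ### Injective modules and high formulas -/

section Injective

variable {R : Type u} [Ring R]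

theorem Module.Injective.isAbsolutelyPure {E : Type (max u v)} [AddCommGroup E] [Module R E]
    (hE : Module.Injective R E) : IsAbsolutelyPure R E := by
  intro L _ _ f hf
  obtain ⟨g, hg⟩ := hE.out f hf LinearMap.id
  exact .of_leftInverse f g hg

variable (R) in
/-- Every module embeds in an injective module. -/
theorem exists_injective_embedding (M : Type (max u v)) [AddCommGroup M] [Module R M] :
    ∃ (E : Type (max u v)) (_ : AddCommGroup E) (_ : Module R E) (f : M →ₗ[R] E),
      Module.Injective R E ∧ Function.Injective f := by
  obtain ⟨⟨J, hJ, f, hf⟩⟩ :=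
    (ModuleCat.enoughInjectives.{max u v, u} R).presentation (ModuleCat.of R M)
  exact ⟨J, inferInstance, inferInstance, f.hom,
    Module.injective_module_of_injective_object R J, (ModuleCat.mono_iff_injective f).1 hf⟩

/-- A formula satisfied by a torsion-free element, such as the image of `1` under an embedding of
`R`, is high. -/
theorem PPFormula.isHigh_of_mem {E : Type (max u v)} [AddCommGroup E] [Module R E] (e : R →ₗ[R] E)
    (he : Function.Injective e) (φ : PPFormula R) (h : e 1 ∈ φ.subgroup E) :
    PPFormula.IsHigh.{u, v} φ := by
  intro M _ _ hM
  refine eq_top_iff.2 fun x _ => ?_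
  obtain ⟨L, _, _, i, hL, hi⟩ := exists_injective_embedding.{u, v} R M
  -- By injectivity of `L`, some `k : E → L` sends `e 1` to `i x`, so `φ` holds at `i x`; absolute
  -- purity of `M` then brings it back to `x`.
  obtain ⟨k, hk⟩ := hL.out (e ∘ₗ ULift.moduleEquiv.{u, u, max u v}.toLinearMap)
    (he.comp ULift.moduleEquiv.injective)
    (i ∘ₗ LinearMap.toSpanSingleton R M x ∘ₗ ULift.moduleEquiv.toLinearMap)
  refine (hM L i hi).2 φ x ?_
  have := φ.map_mem_subgroup k h
  have h1 := hk ⟨1⟩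
  simp at h1
  rwa [h1] at this

/-- The image of an injective module lies in the first Ulm submodule. -/
theorem map_mem_ulm {E : Type (max u v)} [AddCommGroup E] [Module R E] (hE : Module.Injective R E)
    {N : Type v} [AddCommGroup N] [Module R N] (k : E →ₗ[R] N) (x : E) : k x ∈ ulm R N :=
  fun φ hφ => φ.map_mem_subgroup k (by rw [hφ E hE.isAbsolutelyPure]; trivial)

end Injective

/-! ### Purity of `N` in the glued module -/

section Extension

variable {R : Type u} [Ring R] {N : Type v} [AddCommGroup N] [Module R N]
  {A B E : Type (max u v)} [AddCommGroup A] [Module R A] [AddCommGroup B] [Module R B]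
  [AddCommGroup E] [Module R E]

/-- The relations that glue `N` to `B` along `A`, and to every element of `B` a copy of `E`. -/
noncomputable def gluingRelations (f : A →ₗ[R] B) (g : A →ₗ[R] N) (e : R →ₗ[R] E) :
    A × (B →₀ R) →ₗ[R] N × B × (B →₀ E) :=
  (g.prod ((-f).prod 0)).coprod
    ((0 : (B →₀ R) →ₗ[R] N).prod
      ((Finsupp.linearCombination R id).prod (-Finsupp.mapRange.linearMap e)))

theorem gluingRelations_apply (f : A →ₗ[R] B) (g : A →ₗ[R] N) (e : R →ₗ[R] E) (a : A)
    (s : B →₀ R) : gluingRelations f g e (a, s) =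
      (g a, -f a + Finsupp.linearCombination R id s, -Finsupp.mapRange.linearMap e s) := by
  simp [gluingRelations]

/-- If `f` is pure and `g` maps into the first Ulm submodule, then `N` is pure in the module
obtained by gluing. -/
theorem isPureEmbedding_gluing {f : A →ₗ[R] B} (hf : IsPureEmbedding f) {g : A →ₗ[R] N}
    (hg : ∀ a, g a ∈ ulm R N) {e : R →ₗ[R] E} (he : Function.Injective e) :
    IsPureEmbedding ((LinearMap.range (gluingRelations f g e)).mkQ ∘ₗ
      LinearMap.inl R N (B × (B →₀ E))) := by
  classical
  constructor
  · rw [injective_iff_map_eq_zero]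
    intro x hx
    simp only [LinearMap.comp_apply, Submodule.mkQ_apply, Submodule.Quotient.mk_eq_zero,
      LinearMap.mem_range, Prod.exists, LinearMap.inl_apply, gluingRelations_apply,
      Prod.ext_iff, Prod.fst_zero, Prod.snd_zero] at hx
    obtain ⟨a, s, h1, h2, h3⟩ := hx
    have hs : s = 0 := Finsupp.mapRange_injective e (map_zero e) he (by simpa using h3)
    subst hs
    have ha : a = 0 := hf.1 (by simpa using h2)
    rw [← h1, ha, map_zero]
  · rintro φ x ⟨y, hy⟩
    choose y' hy' using fun j => Submodule.mkQ_surjective _ (y j)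
    -- After lifting to the direct sum, each equation holds up to a relation `p i`; `h1`, `h2`, `h3`
    -- are its components in `N`, `B` and the copies of `E`.
    have key : ∀ i, ∃ p, gluingRelations f g e p =
        ∑ j, φ.A i j • y' j - φ.b i • ((x, 0) : N × B × (B →₀ E)) := fun i => by
      rw [← LinearMap.mem_range, ← Submodule.Quotient.mk_eq_zero, ← Submodule.mkQ_apply]
      have := hy i
      simp only [← hy', LinearMap.comp_apply, LinearMap.inl_apply] at this
      rw [map_sub, map_sum, map_smul, sub_eq_zero, ← this]
      simp only [map_smul]
    choose p hp using key
    have h1 : ∀ i, g (p i).1 = ∑ j, φ.A i j • (y' j).1 - φ.b i • x := fun i => by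
      have := congrArg (LinearMap.fst R N (B × (B →₀ E)))
        ((gluingRelations_apply f g e _ _).symm.trans (hp i))
      simpa [Prod.fst_sum] using this
    have h2 : ∀ i, -f (p i).1 + Finsupp.linearCombination R id (p i).2 =
        ∑ j, φ.A i j • (y' j).2.1 := fun i => by
      have := congrArg (LinearMap.fst R B (B →₀ E) ∘ₗ LinearMap.snd R N (B × (B →₀ E)))
        ((gluingRelations_apply f g e _ _).symm.trans (hp i))
      simpa [Prod.fst_sum, Prod.snd_sum, Finsupp.finsetSum_apply] using this
    have h3 : ∀ i b, -e ((p i).2 b) = ∑ j, φ.A i j • (y' j).2.2 b := fun i b => by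
      have := congrArg (Finsupp.lapply b ∘ₗ LinearMap.snd R B (B →₀ E) ∘ₗ
        LinearMap.snd R N (B × (B →₀ E))) ((gluingRelations_apply f g e _ _).symm.trans (hp i))
      simpa [Prod.fst_sum, Prod.snd_sum, Finsupp.finsetSum_apply] using this
    let S : Finset B := Finset.univ.biUnion fun i => (p i).2.support
    have hS : ∀ i, Finsupp.linearCombination R id (p i).2 = ∑ b : S, (p i).2 b • (b : B) :=
      fun i => by
        rw [Finset.sum_coe_sort S fun b => (p i).2 b • b]
        exact Finsupp.sum_of_support_subset _
          (Finset.subset_biUnion_of_mem (fun i => (p i).2.support) (Finset.mem_univ i)) _ (by simp)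
    -- The `B`-components, with the finitely many `b` in `S` also treated as unknowns, solve a
    -- system over `A`.
    obtain ⟨z, hz⟩ := hf.exists_solution (ι := Fin φ.numVars ⊕ S)
      (fun i => Sum.elim (φ.A i) fun b => -(p i).2 b) (fun i => -(p i).1)
      (Sum.elim (fun j => (y' j).2.1) fun b => b) fun i => by
        simp only [Fintype.sum_sum_type, Sum.elim_inl, Sum.elim_inr, neg_smul,
          Finset.sum_neg_distrib, ← hS, ← h2, map_neg]
        abel
    -- By `h3`, `e 1` satisfies the formula with column `-(p i).2 b`, so this formula is high and
    -- holds at `g (z (Sum.inr b))`.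
    have hu : ∀ b : S, ∃ t : Fin φ.numVars → N, ∀ i,
        ∑ j, φ.A i j • t j = (-(p i).2 b) • g (z (Sum.inr b)) := fun b =>
      hg (z (Sum.inr b)) ⟨φ.numEqs, φ.numVars, φ.A, fun i => -(p i).2 b⟩
        (PPFormula.isHigh_of_mem.{u, v} e he _ ⟨fun j => (y' j).2.2 b, fun i => by
          simp only [← h3, ← map_smul, ← map_neg, smul_eq_mul, mul_one]⟩)
    choose t ht using hu
    refine ⟨fun j => (y' j).1 + g (z (Sum.inl j)) + ∑ b, t b j, fun i => ?_⟩
    have hzi := congrArg g (hz i)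
    simp only [Fintype.sum_sum_type, Sum.elim_inl, Sum.elim_inr, map_add, map_sum, map_smul,
      map_neg, h1, ← ht] at hzi
    simp only [smul_add, Finset.sum_add_distrib, Finset.smul_sum]
    rw [Finset.sum_comm, add_assoc, hzi]
    abel

end Extension

/-! ### Retraction onto `N` and the Ulm submodule -/

section Ulm

variable {R : Type u} [Ring R] {N : Type v} [AddCommGroup N] [Module R N]

/-- A map from `A` into the first Ulm submodule of a pure-injective module `N` extends along a pure
embedding `A → B` to a map `B → N`, each value of which is the value at `e 1` of a map `E → N`. -/
theorem IsPureInjective.exists_extension (hN : IsPureInjective R N)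
    {A B E : Type (max u v)} [AddCommGroup A] [Module R A] [AddCommGroup B] [Module R B]
    [AddCommGroup E] [Module R E] {f : A →ₗ[R] B} (hf : IsPureEmbedding f) {g : A →ₗ[R] N}
    (hg : ∀ a, g a ∈ ulm R N) {e : R →ₗ[R] E} (he : Function.Injective e) :
    ∃ h : B →ₗ[R] N, h ∘ₗ f = g ∧ ∀ b, ∃ k : E →ₗ[R] N, k (e 1) = h b := by
  classical
  have hp := isPureEmbedding_gluing hf hg he
  set q := (LinearMap.range (gluingRelations f g e)).mkQ with hq
  have hrel : ∀ a s, q (gluingRelations f g e (a, s)) = 0 := fun a s => by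
    rw [hq, Submodule.mkQ_apply, Submodule.Quotient.mk_eq_zero]
    exact ⟨_, rfl⟩
  let d := ULift.moduleEquiv.{u, v, u} (R := R) (M := N)
  obtain ⟨r, hr⟩ := hN (ULift.{u} N) _ ((q ∘ₗ LinearMap.inl R N _) ∘ₗ d.toLinearMap)
    ⟨hp.1.comp d.injective, fun φ x hx => by
      simpa using φ.map_mem_subgroup d.symm.toLinearMap (hp.2 φ (d x) hx)⟩ d.toLinearMap
  have hr' : ∀ x : N, r (q (x, 0)) = x := fun x => by
    simpa using LinearMap.congr_fun hr (d.symm x)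
  refine ⟨r ∘ₗ q ∘ₗ LinearMap.inr R N _ ∘ₗ LinearMap.inl R B _, ?_, fun b =>
    ⟨r ∘ₗ q ∘ₗ LinearMap.inr R N _ ∘ₗ LinearMap.inr R B _ ∘ₗ Finsupp.lsingle b, ?_⟩⟩
  -- The relation of `(a, 0)` identifies `g a` with `f a`, and `r` fixes `N`.
  · ext a
    have h : (g a, -f a, (0 : B →₀ E)) = (g a, (0 : B × (B →₀ E))) - (0, f a, 0) := by simp
    have := congrArg r (hrel a 0)
    rw [gluingRelations_apply, map_zero, map_zero, add_zero, neg_zero, h, map_sub, map_sub, hr',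
      map_zero, sub_eq_zero] at this
    simpa using this.symm
  -- The relation of `(0, single b 1)` identifies `b` with `e 1` in the copy of `E` indexed by `b`.
  · have h : ((0 : N), b, -Finsupp.single b (e 1)) =
        (0, b, (0 : B →₀ E)) - (0, 0, Finsupp.single b (e 1)) := by simp
    have := congrArg r (hrel 0 (Finsupp.single b 1))
    rw [gluingRelations_apply] at this
    simp only [map_zero, neg_zero, zero_add, Finsupp.linearCombination_single, one_smul, id,
      Finsupp.mapRange.linearMap_apply, Finsupp.mapRange_single, h, map_sub, sub_eq_zero] at this
    simpa using this.symm

theorem map_mem_ulm_of_mem {M : Type v} [AddCommGroup M] [Module R M] (f : M →ₗ[R] N) {x : M}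
    (hx : x ∈ ulm R M) : f x ∈ ulm R N :=
  fun φ hφ => φ.map_mem_subgroup f (hx φ hφ)

theorem ulmOf_top : ulmOf (⊤ : Submodule R N) = ulm R N := by
  refine le_antisymm ?_ fun x hx => ⟨⟨x, trivial⟩, ?_, rfl⟩
  · rintro _ ⟨x, hx, rfl⟩
    exact map_mem_ulm_of_mem _ hx
  · exact map_mem_ulm_of_mem (Submodule.topEquiv (R := R) (M := N)).symm.toLinearMap hx

theorem ulmSeq_zero : ulmSeq R N 0 = ⊤ :=
  Ordinal.limitRecOn_zero ..

theorem ulmSeq_add_one (α : Ordinal.{v}) : ulmSeq R N (α + 1) = ulmOf (ulmSeq R N α) :=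
  Ordinal.limitRecOn_add_one ..

theorem ulmSeq_one : ulmSeq R N 1 = ulm R N := by
  rw [← zero_add 1, ulmSeq_add_one, ulmSeq_zero, ulmOf_top]

theorem hasUlmLength_zero (h : ulm R N = ⊤) : HasUlmLength R N 0 :=
  ⟨by simp only [Set.mem_ofPred_eq, zero_add, ulmSeq_one, ulmSeq_zero, h], fun _ _ => zero_le⟩

theorem exists_hasUlmLength_le {α : Ordinal.{v}} (h : ulmSeq R N (α + 1) = ulmSeq R N α) :
    ∃ τ : Ordinal.{v}, HasUlmLength R N τ ∧ τ ≤ α :=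
  ⟨sInf {α | ulmSeq R N (α + 1) = ulmSeq R N α},
    ⟨csInf_mem (s := {α | ulmSeq R N (α + 1) = ulmSeq R N α}) ⟨α, h⟩, fun _ hβ => csInf_le' hβ⟩,
    csInf_le' h⟩

variable (R) in
/-- `R` embeds in an injective module. -/
theorem exists_injective_embedding_self :
    ∃ (E : Type (max u v)) (_ : AddCommGroup E) (_ : Module R E) (e : R →ₗ[R] E),
      Module.Injective R E ∧ Function.Injective e := by
  obtain ⟨E, _, _, e, hE, he⟩ := exists_injective_embedding.{u, v} R (ULift.{v} R)
  exact ⟨E, _, _, e ∘ₗ ULift.moduleEquiv.symm.toLinearMap, hE,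
    he.comp ULift.moduleEquiv.symm.injective⟩

theorem IsPureInjective.ulm (hN : IsPureInjective R N) : IsPureInjective R (ulm R N) := by
  intro A B _ _ _ _ f hf g
  obtain ⟨E, _, _, e, hE, he⟩ := exists_injective_embedding_self.{u, v} R
  obtain ⟨h, hh, hk⟩ := hN.exists_extension hf (g := (_root_.ulm R N).subtype ∘ₗ g)
    (fun a => (g a).2) he
  refine ⟨h.codRestrict _ fun b => ?_, ?_⟩
  · obtain ⟨k, hk⟩ := hk b
    exact hk ▸ map_mem_ulm hE k _
  · ext a
    exact LinearMap.congr_fun hh a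

/-- Each `x` in u(N) is `k (e 1)` for some `k : E → N`. Since `k` has its image in u(N), it is also
a map from an injective module to u(N), which puts `x` in u(u(N)). -/
theorem IsPureInjective.ulm_ulm (hN : IsPureInjective R N) : _root_.ulm R (_root_.ulm R N) = ⊤ := by
  refine eq_top_iff.2 fun x _ => ?_
  obtain ⟨E, _, _, e, hE, he⟩ := exists_injective_embedding_self.{u, v} R
  let d := ULift.moduleEquiv.{u, v, u} (R := R) (M := _root_.ulm R N)
  obtain ⟨h, hh, hk⟩ := hN.exists_extension
    (.of_leftInverse (LinearMap.id : ULift.{u} (_root_.ulm R N) →ₗ[R] _) LinearMap.id fun _ => rfl)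
    (g := (_root_.ulm R N).subtype ∘ₗ d.toLinearMap) (fun a => (d a).2) he
  obtain ⟨k, hk⟩ := hk (d.symm x)
  have hx : k.codRestrict (_root_.ulm R N) (map_mem_ulm hE k) (e 1) = x := by
    ext
    rw [LinearMap.codRestrict_apply, hk]
    simpa using LinearMap.congr_fun hh (d.symm x)
  exact hx ▸ map_mem_ulm hE _ _

end Ulm

theorem mainTheorem5 {R : Type u} [Ring R] {N : Type v} [AddCommGroup N] [Module R N]
    (hN : IsPureInjective R N) :
    IsPureInjective R (ulm R N) ∧
      HasUlmLength R (ulm R N) 0 ∧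
      ulmOf (ulm R N) = ulm R N ∧
      ∃ τ : Ordinal.{v}, HasUlmLength R N τ ∧ τ ≤ 1 := by
  have h : ulmOf (ulm R N) = ulm R N := by
    rw [ulmOf, hN.ulm_ulm, Submodule.map_top, Submodule.range_subtype]
  exact ⟨hN.ulm, hasUlmLength_zero hN.ulm_ulm, h,
    exists_hasUlmLength_le (by rw [ulmSeq_add_one, ulmSeq_one, h])⟩
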